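/- **Theorem.** For an integer $N>0$ with $N\equiv 0,3\pmod 4$, let the Hurwitz class number $H(N)$ be the number of classes, under the action of $\mathrm{SL}_2(\mathbb Z)$, of positive definite integral binary quadratic forms $ax^2+bxy+cy^2$ (not necessarily primitive) of discriminant $b^2-4ac=-N$, where a class containing an integral multiple of $x^2+y^2$ is counted with weight $1/2$ and a class containing an integral multiple of $x^2+xy+y^2$ is counted with weight $1/3$ (all other classes have weight $1$); put also $H(0)=-1/12$ and $H(N)=0$ for $N\equiv 1,2\pmod 4$. For $N\equiv 3\pmod 4$ let $$F(N)=\begin{cases}3H(N), & N\equiv 3\pmod 8,\\ H(N), & N\equiv 7\pmod 8.\end{cases}$$ For $n\ge 1$ let $P(n)$ be the number of compositions of $n$ (finite sequences of positive integers with sum $n$) that are strongly unimodal, i.e. strictly increasing up to a peak and strictly decreasing after it (either side of the peak may be empty), and in which any two successive parts have absolute difference exactly $1$. Then for every integer $n\ge 1$, $$P(n)=F(4n-1).$$ -/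

import Mathlib

/-- An integral binary quadratic form `a x² + b x y + c y²`, given by its coefficients. -/
@[ext]
structure BinForm where
  a : ℤ
  b : ℤ
  c : ℤ

namespace BinForm

/-- The value `f(x, y) = a x² + b x y + c y²`. -/
def eval (f : BinForm) (x y : ℤ) : ℤ := f.a * x ^ 2 + f.b * x * y + f.c * y ^ 2

/-- The discriminant `b² - 4ac`. -/
def disc (f : BinForm) : ℤ := f.b ^ 2 - 4 * f.a * f.c

/-- Positive definiteness: `f(x, y) > 0` for all `(x, y) ≠ (0, 0)`. -/
def PosDef (f : BinForm) : Prop := ∀ x y : ℤ, (x, y) ≠ (0, 0) → 0 < f.eval x y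

/-- Proper equivalence: `g` arises from `f` by a substitution
`(x, y) ↦ (γ₀₀ x + γ₀₁ y, γ₁₀ x + γ₁₁ y)` with `γ` an integral matrix of determinant `1`. -/
def Equivalent (f g : BinForm) : Prop :=
  ∃ γ : Matrix.SpecialLinearGroup (Fin 2) ℤ, ∀ x y : ℤ,
    g.eval x y = f.eval (γ 0 0 * x + γ 0 1 * y) (γ 1 0 * x + γ 1 1 * y)

theorem Equivalent.refl (f : BinForm) : f.Equivalent f := ⟨1, fun x y => by simp⟩

theorem Equivalent.symm {f g : BinForm} (h : f.Equivalent g) : g.Equivalent f := by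
  obtain ⟨γ, h⟩ := h
  have hd : γ 0 0 * γ 1 1 - γ 0 1 * γ 1 0 = 1 := by
    rw [← Matrix.det_fin_two]; exact γ.2
  refine ⟨γ⁻¹, fun x y => ?_⟩
  rw [h]
  simp only [Matrix.SpecialLinearGroup.SL2_inv_expl, Matrix.cons_val_zero,
    Matrix.cons_val_one, Matrix.cons_val']
  congr 1
  · linear_combination (-x) * hd
  · linear_combination (-y) * hd

theorem Equivalent.trans {f g h : BinForm} (hfg : f.Equivalent g) (hgh : g.Equivalent h) :
    f.Equivalent h := by
  obtain ⟨γ, h₁⟩ := hfg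
  obtain ⟨δ, h₂⟩ := hgh
  refine ⟨γ * δ, fun x y => ?_⟩
  rw [h₂, h₁]
  simp only [Matrix.SpecialLinearGroup.coe_mul, Matrix.mul_apply, Fin.sum_univ_two]
  congr 1 <;> ring

end BinForm

/-- The positive definite integral binary quadratic forms (primitive or not) of
discriminant `-N`. -/
abbrev PosDefForm (N : ℕ) : Type := {f : BinForm // f.PosDef ∧ f.disc = -(N : ℤ)}

/-- Proper equivalence on the positive definite forms of discriminant `-N`. -/
instance formSetoid (N : ℕ) : Setoid (PosDefForm N) where
  r f g := f.1.Equivalent g.1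
  iseqv := ⟨fun f => .refl f.1, fun h => h.symm, fun h₁ h₂ => h₁.trans h₂⟩

/-- The classes of positive definite binary quadratic forms of discriminant `-N`. -/
abbrev FormClass (N : ℕ) : Type := Quotient (formSetoid N)

/-- The class `C` contains an integral multiple of the form `f₀`. -/
def FormClass.ContainsMultipleOf {N : ℕ} (C : FormClass N) (f₀ : BinForm) : Prop :=
  ∃ f : PosDefForm N, (Quotient.mk (formSetoid N) f) = C ∧
    ∃ k : ℤ, f.1 = ⟨k * f₀.a, k * f₀.b, k * f₀.c⟩

open Classical in
/-- The weight of a class: `1/2` if it contains a multiple of `x² + y²`, `1/3` if it contains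
a multiple of `x² + xy + y²`, and `1` otherwise. -/
noncomputable def FormClass.weight {N : ℕ} (C : FormClass N) : ℚ :=
  if C.ContainsMultipleOf ⟨1, 0, 1⟩ then 1 / 2
  else if C.ContainsMultipleOf ⟨1, 1, 1⟩ then 1 / 3
  else 1

/-- Every class of discriminant `-N` contains a form with
`|b| ≤ a ≤ c`. -/
theorem FormClass.exists_reduced {N : ℕ} (C : FormClass N) :
    ∃ f : PosDefForm N, (Quotient.mk (formSetoid N) f) = C ∧ 0 < f.1.a ∧
      |f.1.b| ≤ f.1.a ∧ f.1.a ≤ f.1.c := by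
  have hpos : ∀ f : PosDefForm N, 0 < f.1.a := fun f => by
    simpa [BinForm.eval] using f.2.1 1 0 (by simp)
  -- Move a form by a matrix of determinant one.
  have move : ∀ (f : PosDefForm N) (g : BinForm), f.1.Equivalent g → g.disc = f.1.disc →
      ∃ g' : PosDefForm N, g'.1 = g ∧
        (Quotient.mk (formSetoid N) g') = Quotient.mk (formSetoid N) f := by
    intro f g hfg hd
    refine ⟨⟨g, ?_, hd.trans f.2.2⟩, rfl, Quotient.sound hfg.symm⟩
    obtain ⟨γ, h⟩ := hfg
    have hdet : γ 0 0 * γ 1 1 - γ 0 1 * γ 1 0 = 1 := by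
      rw [← Matrix.det_fin_two]; exact γ.2
    intro x y hxy
    rw [h]
    refine f.2.1 _ _ fun h0 => hxy ?_
    simp only [Prod.mk.injEq] at h0 ⊢
    constructor
    · linear_combination (-x) * hdet + γ 1 1 * h0.1 - γ 0 1 * h0.2
    · linear_combination (-y) * hdet - γ 1 0 * h0.1 + γ 0 0 * h0.2
  -- Choose a form of the class with smallest `a`, then with smallest `|b|`.
  let S : Set (PosDefForm N) := {f | (Quotient.mk (formSetoid N) f) = C}
  have hS : S.Nonempty := C.exists_rep
  let m : PosDefForm N → ℕ ×ₗ ℕ := fun f => toLex (f.1.a.natAbs, f.1.b.natAbs)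
  obtain ⟨f, hfS, hmin⟩ : ∃ f ∈ S, ∀ g ∈ S, ¬ m g < m f :=
    (InvImage.wf m wellFounded_lt).has_min S hS
  have hfa := hpos f
  refine ⟨f, hfS, hfa, ?_, ?_⟩
  · have key : ∀ t : ℤ, f.1.b.natAbs ≤ (f.1.b + 2 * f.1.a * t).natAbs := by
      intro t
      obtain ⟨g, hg, hgf⟩ := move f ⟨f.1.a, f.1.b + 2 * f.1.a * t,
          f.1.a * t ^ 2 + f.1.b * t + f.1.c⟩
        ⟨⟨!![1, t; 0, 1], by simp⟩, fun x y => by simp [BinForm.eval]; ring⟩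
        (by simp only [BinForm.disc]; ring)
      have := hmin g (hgf.trans hfS)
      simp only [m, Prod.Lex.toLex_lt_toLex, hg, lt_irrefl, true_and, false_or] at this
      exact not_lt.mp this
    have h₁ := key 1
    have h₂ := key (-1)
    rw [abs_le]
    constructor <;> omega
  · obtain ⟨g, hg, hgf⟩ := move f ⟨f.1.c, -f.1.b, f.1.a⟩
      ⟨⟨!![0, -1; 1, 0], by simp⟩, fun x y => by simp [BinForm.eval]; ring⟩
      (by simp only [BinForm.disc]; ring)
    have := hmin g (hgf.trans hfS)
    have hga := hpos g
    simp only [m, Prod.Lex.toLex_lt_toLex, hg, not_or] at this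
    rw [hg] at hga
    simp only at hga
    omega

/-- There are only finitely many classes, so that the sum over them below is a finite sum. -/
instance finite_formClass (N : ℕ) : Finite (FormClass N) := by
  choose r hr hr0 hr1 hr2 using fun C : FormClass N => C.exists_reduced
  let B : Set ℤ := Set.Icc (-(N : ℤ)) N
  have hmem : ∀ C, (r C).1.a ∈ B ∧ (r C).1.b ∈ B ∧ (r C).1.c ∈ B := by
    intro C
    have hd := (r C).2.2
    have h0 := hr0 C
    have h1 := abs_le.mp (hr1 C)
    have h2 := hr2 C
    simp only [BinForm.disc] at hd
    have hb : (r C).1.b ^ 2 ≤ (r C).1.a * (r C).1.c := by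
      nlinarith [h1.1, h1.2]
    have hc : (r C).1.c ≤ N := by nlinarith
    simp only [B, Set.mem_Icc]
    refine ⟨⟨?_, ?_⟩, ⟨?_, ?_⟩, ?_, ?_⟩ <;> linarith [h1.1, h1.2]
  refine Finite.of_injective
    (fun C => ((⟨_, (hmem C).1⟩, ⟨_, (hmem C).2.1⟩, ⟨_, (hmem C).2.2⟩) : B × B × B)) ?_
  intro C D h
  simp only [Prod.mk.injEq, Subtype.mk.injEq] at h
  rw [← hr C, ← hr D]
  exact congrArg _ (Subtype.ext (BinForm.ext h.1 h.2.1 h.2.2))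

/-- The Hurwitz class number `H(N)`. -/
noncomputable def hurwitzH (N : ℕ) : ℚ :=
  if N = 0 then -1 / 12
  else if N % 4 = 1 ∨ N % 4 = 2 then 0
  else ∑ᶠ C : FormClass N, C.weight

/-- Kronecker's function `F` at the arguments `N ≡ 3 (mod 4)`:
`F(N) = 3 H(N)` if `N ≡ 3 (mod 8)` and `F(N) = H(N)` if `N ≡ 7 (mod 8)`.
Only such arguments are meant; the value `0` elsewhere is a placeholder. -/
noncomputable def kroneckerF (N : ℕ) : ℚ :=
  if N % 8 = 3 then 3 * hurwitzH N
  else if N % 8 = 7 then hurwitzH N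
  else 0

/-- A sequence is strongly unimodal if it strictly increases up to a peak `p` and strictly
decreases from there on (either side of the peak may be empty). -/
def StronglyUnimodal (l : List ℕ) : Prop :=
  ∃ (l₁ : List ℕ) (p : ℕ) (l₂ : List ℕ), l = l₁ ++ p :: l₂ ∧
    (l₁ ++ [p]).IsChain (· < ·) ∧ (p :: l₂).IsChain (· > ·)

/-- Successive entries have absolute difference `1`. -/
def StepsOne (l : List ℕ) : Prop :=
  l.IsChain fun a b => |(a : ℤ) - (b : ℤ)| = 1

/-- `P(n)`: the number of strongly unimodal compositions of `n` whose successive parts have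
absolute difference `1`. -/
noncomputable def numP (n : ℕ) : ℕ :=
  Nat.card {c : Composition n // StronglyUnimodal c.blocks ∧ StepsOne c.blocks}

/-! A strongly unimodal composition with unit steps is determined by its peak `p` and the numbers
`i, j < p` of parts before and after the peak. Put `u = 2p - i - j - 1` and `v = j - i`. Then `4n -
1 = 4p² - u² - v²` (`four_mul_sum_peakList`), and `u`, `v` have opposite parity. If `e` is the even
one and `b` the odd one, then `4p² - e² = 4(p - |e|/2)(p + |e|/2)`, so `a = p - |e|/2`, `c = p +
|e|/2` and `±b` give a form of discriminant `-(4n - 1)` with `a + c` even, `|b| < 2a` and `a ≤ c`.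
These are exactly the forms reduced for the theta group, which has index `3` in the modular group
(`card_peakData`).

It remains to count theta-reduced forms class by class (`ThetaReducedForm.card_fiber`). The domain
`|Re z| < 1`, `|z| ≥ 1` is covered by three kinds of images of the standard domain, so a class with
reduced form `r` has at most three candidates: `r`, `r.translate` and `r.invTranslate`. If `N ≡ 7
(mod 8)`, the condition that `a + c` be even selects one of them. If `N ≡ 3 (mod 8)`, it selects all
three, except that for multiples of `x² + xy + y²` only one survives, in accordance with the weight
`1/3`. -/

namespace BinForm

/-! ### Substitutions of determinant one in terms of coefficients. -/

theorem posDef_of_disc_neg {f : BinForm} (ha : 0 < f.a) (hd : f.disc < 0) : f.PosDef := by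
  intro x y hxy
  have key : 4 * f.a * f.eval x y = (2 * f.a * x + f.b * y) ^ 2 + (-f.disc) * y ^ 2 := by
    simp only [eval, disc]; ring
  have hpos : 0 < 4 * f.a * f.eval x y := by
    rw [key]
    by_cases hy : y = 0
    · have hx : x ≠ 0 := fun hx => hxy (by simp [hx, hy])
      have : 2 * f.a * x ≠ 0 := mul_ne_zero (by omega) hx
      simp only [hy]
      ring_nf
      positivity
    · have h1 : 0 < (-f.disc) * y ^ 2 := mul_pos (by omega) (by positivity)
      positivity
  exact pos_of_mul_pos_right hpos (by omega)

theorem PosDef.a_pos {f : BinForm} (h : f.PosDef) : 0 < f.a := by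
  simpa [eval] using h 1 0 (by simp)

/-- The coefficients of a form obtained by a substitution of determinant `1`. -/
theorem Equivalent.exists_coeffs {f g : BinForm} (h : f.Equivalent g) :
    ∃ p q s t : ℤ, p * t - q * s = 1 ∧
      g.a = f.a * p ^ 2 + f.b * p * s + f.c * s ^ 2 ∧
      g.b = 2 * f.a * p * q + f.b * (p * t + q * s) + 2 * f.c * s * t ∧
      g.c = f.a * q ^ 2 + f.b * q * t + f.c * t ^ 2 := by
  obtain ⟨γ, h⟩ := h
  have hdet : γ 0 0 * γ 1 1 - γ 0 1 * γ 1 0 = 1 := by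
    rw [← Matrix.det_fin_two]; exact γ.2
  have h10 := h 1 0
  have h01 := h 0 1
  have h11 := h 1 1
  simp only [eval] at h10 h01 h11
  refine ⟨γ 0 0, γ 0 1, γ 1 0, γ 1 1, hdet, ?_, ?_, ?_⟩
  · linear_combination h10
  · linear_combination h11 - h10 - h01
  · linear_combination h01

theorem equivalent_of_coeffs {f g : BinForm} (p q s t : ℤ) (hdet : p * t - q * s = 1)
    (ha : g.a = f.a * p ^ 2 + f.b * p * s + f.c * s ^ 2)
    (hb : g.b = 2 * f.a * p * q + f.b * (p * t + q * s) + 2 * f.c * s * t)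
    (hc : g.c = f.a * q ^ 2 + f.b * q * t + f.c * t ^ 2) : f.Equivalent g := by
  refine ⟨⟨!![p, q; s, t], by rw [Matrix.det_fin_two_of]; exact hdet⟩, fun x y => ?_⟩
  simp only [eval, ha, hb, hc, Matrix.of_apply, Matrix.cons_val', Matrix.cons_val_zero,
    Matrix.cons_val_one, Matrix.cons_val_fin_one]
  ring

theorem Equivalent.disc_eq {f g : BinForm} (h : f.Equivalent g) : g.disc = f.disc := by
  obtain ⟨p, q, s, t, hdet, ha, hb, hc⟩ := h.exists_coeffs
  simp only [disc, ha, hb, hc]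
  linear_combination (f.b ^ 2 - 4 * f.a * f.c) * (p * t - q * s + 1) * hdet

/-! ### Uniqueness of the reduced form in a class. -/

/-- Reduced forms, with the usual normalisation on the boundary of the fundamental domain. -/
structure Reduced (f : BinForm) : Prop where
  a_pos : 0 < f.a
  neg_a_lt_b : -f.a < f.b
  b_le_a : f.b ≤ f.a
  a_le_c : f.a ≤ f.c
  b_nonneg : f.a = f.c → 0 ≤ f.b

/-- The uniqueness of reduced forms, in the case of a substitution whose lower left entry is
`1` or `-1`. -/
theorem Reduced.eq_of_substitution {a b c a' b' c' k m : ℤ} (hf : (BinForm.mk a b c).Reduced)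
    (hg : (BinForm.mk a' b' c').Reduced) (hle : a' ≤ a)
    (hdisc : b' ^ 2 - 4 * a' * c' = b ^ 2 - 4 * a * c) (ha2 : a' = a * k ^ 2 + b * k + c)
    (hb2 : b' = 2 * a * k * (k * m - 1) + b * (2 * k * m - 1) + 2 * c * m) :
    a' = a ∧ b' = b := by
  obtain ⟨f1, f2, f3, f4, f5⟩ := hf
  obtain ⟨g1, g2, g3, g4, g5⟩ := hg
  simp only at f1 f2 f3 f4 f5 g1 g2 g3 g4 g5
  have hk1 : k < 2 := by
    by_contra
    nlinarith only [mul_nonneg (by omega : 0 ≤ b + a) (by omega : 0 ≤ k), f1, f4, hle, ha2,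
      mul_nonneg f1.le (mul_nonneg (by omega : 0 ≤ k - 2) (by omega : 0 ≤ k + 1))]
  have hk2 : -2 < k := by
    by_contra
    nlinarith only [mul_nonneg (by omega : 0 ≤ a - b) (by omega : 0 ≤ -k), f1, f4, hle, ha2,
      mul_nonneg f1.le (mul_nonneg (by omega : 0 ≤ -k - 2) (by omega : 0 ≤ -k + 1))]
  -- With `|b| ≤ a ≤ c`, the inequality `a k² + b k + c ≤ a` forces `a = b = c` if `k = -1` and `a =
  -- c` if `k = 0`; the case `k = 1` contradicts `-a < b`.
  rcases (by omega : k = -1 ∨ k = 0 ∨ k = 1) with rfl | rfl | rfl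
  · have hc : c = a := by linarith
    have hb : b = a := by linarith
    subst hc hb
    have ea : a' = b := by linarith
    have hb3 : b' = b * (1 + 2 * m) := by linear_combination hb2
    have hm0 : m < 1 := by
      by_contra
      nlinarith only [mul_le_mul_of_nonneg_left (by omega : 1 ≤ m) f1.le, g3, hb3, ea, f1]
    have hm1 : -1 < m := by
      by_contra
      nlinarith only [mul_le_mul_of_nonneg_left (by omega : m ≤ -1) f1.le, g2, hb3, ea]
    obtain rfl : m = 0 := by omega
    exact ⟨ea, by linarith⟩
  · have hc : c = a := by linarith
    subst hc
    have ea : a' = c := by linarith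
    have h0 := f5 rfl
    have hb3 : b' = -b + 2 * (c * m) := by linear_combination hb2
    have hm0 : m < 2 := by
      by_contra
      linarith [mul_le_mul_of_nonneg_left (by omega : 2 ≤ m) f1.le]
    have hm1 : -1 < m := by
      by_contra
      linarith [mul_le_mul_of_nonneg_left (by omega : m ≤ -1) f1.le]
    rcases (by omega : m = 0 ∨ m = 1) with rfl | rfl
    · have hc3 : c' = c := by
        rw [ea, hb3] at hdisc
        exact mul_left_cancel₀ (by omega : 4 * c ≠ 0) (by linear_combination -hdisc)
      have := g5 (by omega)
      exact ⟨ea, by omega⟩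
    · exact ⟨ea, by linarith⟩
  · linarith

theorem Reduced.eq_of_equivalent_of_a_le {f g : BinForm} (hf : f.Reduced) (hg : g.Reduced)
    (h : f.Equivalent g) (hle : g.a ≤ f.a) : g = f := by
  have hdisc := h.disc_eq
  obtain ⟨p, q, s, t, hdet, ha, hb, hc⟩ := h.exists_coeffs
  have ⟨f1, f2, f3, f4, f5⟩ := hf
  have ⟨g1, g2, g3, g4, g5⟩ := hg
  obtain ⟨a, b, c⟩ := f
  obtain ⟨a', b', c'⟩ := g
  simp only [disc, mk.injEq] at *
  -- Once the first two coefficients agree, so does the third.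
  have finish : a' = a → b' = b → a' = a ∧ b' = b ∧ c' = c := by
    rintro rfl rfl
    refine ⟨rfl, rfl, ?_⟩
    have : (4 * a') * c' = (4 * a') * c := by linarith
    exact mul_left_cancel₀ (by omega) this
  have hbb : b ^ 2 ≤ a * c := by nlinarith
  -- Completing the square gives `3ac s² ≤ 4aa' ≤ 4ac`.
  have hs : s ^ 2 < 4 := by
    by_contra hs
    have key : 4 * a * a' = (2 * a * p + b * s) ^ 2 + (4 * a * c - b ^ 2) * s ^ 2 := by
      rw [ha]; ring
    have h1 : 3 * (a * c) * 4 ≤ (4 * a * c - b ^ 2) * s ^ 2 :=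
      mul_le_mul (by linarith) (by omega) (by norm_num) (by nlinarith)
    nlinarith [sq_nonneg (2 * a * p + b * s)]
  have hs1 : -2 < s := by nlinarith
  have hs2 : s < 2 := by nlinarith
  have congr_b : ∀ k : ℤ, a' = a → b' = b + 2 * a * k → b' = b := by
    rintro k rfl hk
    have : k < 1 := by by_contra; nlinarith
    have : -1 < k := by by_contra; nlinarith
    obtain rfl : k = 0 := by omega
    simpa using hk
  rcases (by omega : s = 0 ∨ s ≠ 0) with rfl | hs0
  · have hp : p = 1 ∧ t = 1 ∨ p = -1 ∧ t = -1 := by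
      apply Int.mul_eq_one_iff_eq_one_or_neg_one.1; linarith
    have hpp : p ^ 2 = 1 := by rcases hp with ⟨rfl, -⟩ | ⟨rfl, -⟩ <;> norm_num
    have ea : a' = a := by rw [ha]; linear_combination a * hpp
    exact finish ea (congr_b (p * q) ea (by linear_combination hb + b * hdet))
  -- Now the lower left entry is `1` or `-1`.
  have hss : s * s = 1 := by
    rcases (by omega : s = 1 ∨ s = -1) with rfl | rfl <;> norm_num
  -- Multiplying the matrix by `s = ±1` does not change its action on forms and makes the lower left
  -- entry `1`; `k` and `m` are then the diagonal entries.
  obtain ⟨k, hk⟩ : ∃ k, k = p * s := ⟨_, rfl⟩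
  have hkk : k ^ 2 = p ^ 2 := by rw [hk]; linear_combination p ^ 2 * hss
  have ha2 : a' = a * k ^ 2 + b * k + c := by rw [ha, hkk, hk]; linear_combination c * hss
  obtain ⟨m, hm⟩ : ∃ m, m = s * t := ⟨_, rfl⟩
  have hq : q * s = k * m - 1 := by rw [hk, hm]; linear_combination -hdet - p * t * hss
  have hb2 : b' = 2 * a * k * (k * m - 1) + b * (2 * k * m - 1) + 2 * c * m := by
    have e1 : p * t = k * m := by rw [hk, hm]; linear_combination -p * t * hss
    have e2 : p * q = k * (k * m - 1) := by
      rw [← hq, hk]; linear_combination -p * q * hss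
    linear_combination hb + 2 * a * e2 + b * (e1 + hq) - 2 * c * hm
  obtain ⟨ea, eb⟩ := hf.eq_of_substitution hg hle hdisc ha2 hb2
  exact finish ea eb

theorem Reduced.eq_of_equivalent {f g : BinForm} (hf : f.Reduced) (hg : g.Reduced)
    (h : f.Equivalent g) : g = f := by
  rcases le_total g.a f.a with hle | hle
  · exact hf.eq_of_equivalent_of_a_le hg h hle
  · exact (hg.eq_of_equivalent_of_a_le hf h.symm hle).symm

/-! ### Theta-reduced forms inside one class. -/

/-- Reduced forms for the theta group: the roots lie in `|Re z| < 1`, `|z| ≥ 1`, and the form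
is fixed by the theta group modulo `2`. -/
structure ThetaReduced (f : BinForm) : Prop where
  neg_lt_b : -(2 * f.a) < f.b
  b_lt : f.b < 2 * f.a
  a_le_c : f.a ≤ f.c
  b_pos : f.a = f.c → 0 < f.b
  even : (f.a + f.c) % 2 = 0

/-- The translate of `f` by `1` or `-1`, against the sign of the middle coefficient. -/
def translate (f : BinForm) : BinForm :=
  if 0 < f.b then ⟨f.a, f.b - 2 * f.a, f.a + f.c - f.b⟩
  else ⟨f.a, f.b + 2 * f.a, f.a + f.c + f.b⟩

/-- The image of `f` under the inversion, followed by a translation by `1` or `-1`. -/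
def invTranslate (f : BinForm) : BinForm :=
  if 0 < f.b then ⟨f.c, 2 * f.c - f.b, f.a + f.c - f.b⟩
  else ⟨f.c, -(2 * f.c) - f.b, f.a + f.c + f.b⟩

theorem equivalent_translate (f : BinForm) : f.Equivalent f.translate := by
  unfold translate
  split_ifs
  · apply equivalent_of_coeffs 1 (-1) 0 1 <;> ring
  · apply equivalent_of_coeffs 1 1 0 1 <;> ring

theorem equivalent_invTranslate (f : BinForm) : f.Equivalent f.invTranslate := by
  unfold invTranslate
  split_ifs
  · apply equivalent_of_coeffs 0 (-1) 1 1 <;> ring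
  · apply equivalent_of_coeffs 0 (-1) 1 (-1) <;> ring

/-- The part of the theta domain with `|b| ≤ a` is standard, up to the edge `b = -a`. Elsewhere a
unit translation brings `|b|` below `a`; the form is then reduced unless its last coefficient has
dropped below `a`, in which case an inversion finishes. -/
theorem ThetaReduced.exists_reduced {f : BinForm} (hf : f.ThetaReduced) (hb : f.b % 2 = 1) :
    ∃ r : BinForm, r.Reduced ∧ (f = r ∨ f = r.translate ∨ f = r.invTranslate) := by
  obtain ⟨h1, h2, h3, h4, -⟩ := hf
  obtain ⟨a, b, c⟩ := f
  simp only at *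
  rcases lt_or_ge (-a) b with h5 | h5
  · rcases le_or_gt b a with h6 | h6
    · exact ⟨⟨a, b, c⟩, ⟨by simp only; omega, h5, h6, h3, fun h => (h4 h).le⟩, Or.inl rfl⟩
    · rcases lt_or_ge b c with h7 | h7
      · refine ⟨⟨a, b - 2 * a, a + c - b⟩, ⟨?_, ?_, ?_, ?_, ?_⟩, Or.inr (Or.inl ?_)⟩ <;>
          simp only [translate]
        iterate 5 omega
        rw [if_neg (by omega)]; simp only [mk.injEq]; exact ⟨trivial, by ring, by ring⟩
      · refine ⟨⟨a + c - b, 2 * a - b, a⟩, ⟨?_, ?_, ?_, ?_, ?_⟩, Or.inr (Or.inr ?_)⟩ <;>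
          simp only [invTranslate]
        iterate 5 omega
        rw [if_pos (by omega)]; simp only [mk.injEq]; exact ⟨trivial, by ring, by ring⟩
  · rcases le_or_gt (-b) c with h7 | h7
    · refine ⟨⟨a, b + 2 * a, a + c + b⟩, ⟨?_, ?_, ?_, ?_, ?_⟩, Or.inr (Or.inl ?_)⟩ <;>
        simp only [translate]
      iterate 5 omega
      rw [if_pos (by omega)]; simp only [mk.injEq]; exact ⟨trivial, by ring, by ring⟩
    · refine ⟨⟨a + c + b, -(2 * a) - b, a⟩, ⟨?_, ?_, ?_, ?_, ?_⟩, Or.inr (Or.inr ?_)⟩ <;>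
        simp only [invTranslate]
      iterate 5 omega
      rw [if_neg (by omega)]; simp only [mk.injEq]; exact ⟨trivial, by ring, by ring⟩

/-- The forms in the class of a reduced form `r` that are reduced for the theta group. -/
theorem Reduced.thetaReduced_equivalent_iff {r g : BinForm} (hr : r.Reduced)
    (hd : r.disc % 2 = 1) :
    (g.ThetaReduced ∧ r.Equivalent g) ↔
      (g.ThetaReduced ∧ (g = r ∨ g = r.translate ∨ g = r.invTranslate)) := by
  refine and_congr_right fun hg => ⟨fun h => ?_, ?_⟩
  · have hb : g.b % 2 = 1 := by
      rw [← h.disc_eq, disc, mul_assoc] at hd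
      rcases Int.emod_two_eq_zero_or_one g.b with h0 | h0
      · have : g.b ^ 2 % 2 = 0 := by rw [pow_two, Int.mul_emod, h0]; rfl
        omega
      · exact h0
    obtain ⟨r', hr', h'⟩ := hg.exists_reduced hb
    have he : r'.Equivalent g := by
      rcases h' with rfl | rfl | rfl
      exacts [.refl _, equivalent_translate _, equivalent_invTranslate _]
    rwa [hr.eq_of_equivalent hr' (h.trans he.symm)] at h'
  · rintro (rfl | rfl | rfl)
    exacts [.refl _, equivalent_translate _, equivalent_invTranslate _]

theorem Reduced.thetaReduced_iff {r : BinForm} (hr : r.Reduced) (hb : r.b % 2 = 1) :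
    r.ThetaReduced ↔ (r.a + r.c) % 2 = 0 := by
  obtain ⟨f1, f2, f3, f4, f5⟩ := hr
  exact ⟨fun h => h.even, fun h => ⟨by omega, by omega, by omega, by omega, h⟩⟩

theorem Reduced.thetaReduced_translate_iff {r : BinForm} (hr : r.Reduced) (hb : r.b % 2 = 1) :
    r.translate.ThetaReduced ↔ r.c % 2 = 1 ∧ ¬(r.a = r.b ∧ r.b = r.c) := by
  obtain ⟨f1, f2, f3, f4, f5⟩ := hr
  unfold translate
  constructor
  · rintro ⟨h1, h2, h3, h4, h5⟩
    split_ifs at * <;> simp only at * <;> omega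
  · intro h
    constructor <;> split_ifs <;> simp only at * <;> omega

theorem Reduced.thetaReduced_invTranslate_iff {r : BinForm} (hr : r.Reduced)
    (hb : r.b % 2 = 1) : r.invTranslate.ThetaReduced ↔ r.a % 2 = 1 := by
  obtain ⟨f1, f2, f3, f4, f5⟩ := hr
  unfold invTranslate
  constructor
  · rintro ⟨h1, h2, h3, h4, h5⟩
    split_ifs at * <;> simp only at * <;> omega
  · intro h
    constructor <;> split_ifs <;> simp only at * <;> omega

/-- The number of theta-reduced forms in the class of a reduced form. -/
theorem Reduced.ncard_thetaReduced {r : BinForm} (hr : r.Reduced) (hb : r.b % 2 = 1) :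
    {g : BinForm | g.ThetaReduced ∧ (g = r ∨ g = r.translate ∨ g = r.invTranslate)}.ncard =
      if r.a % 2 = 1 ∧ r.c % 2 = 1 ∧ ¬(r.a = r.b ∧ r.b = r.c) then 3 else 1 := by
  have i1 := hr.thetaReduced_iff hb
  have i2 := hr.thetaReduced_translate_iff hb
  have i3 := hr.thetaReduced_invTranslate_iff hb
  have hset : {g : BinForm | g.ThetaReduced ∧
      (g = r ∨ g = r.translate ∨ g = r.invTranslate)} =
      {g | ((r.a + r.c) % 2 = 0 ∧ g = r) ∨
        ((r.c % 2 = 1 ∧ ¬(r.a = r.b ∧ r.b = r.c)) ∧ g = r.translate) ∨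
        (r.a % 2 = 1 ∧ g = r.invTranslate)} := by
    ext g
    simp only [Set.mem_ofPred_eq, ← i1, ← i2, ← i3]
    constructor
    · rintro ⟨h, rfl | rfl | rfl⟩ <;> simp [h]
    · rintro (⟨h, rfl⟩ | ⟨h, rfl⟩ | ⟨h, rfl⟩) <;> simp [h]
  rw [hset]
  obtain ⟨f1, f2, f3, f4, f5⟩ := hr
  split_ifs with h
  · rw [Set.ncard_eq_three]
    refine ⟨r, r.translate, r.invTranslate, ?_, ?_, ?_, ?_⟩
    · intro e
      have := congrArg BinForm.b e
      unfold translate at this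
      split_ifs at this <;> simp only at this <;> omega
    · intro e
      have := congrArg BinForm.a e
      have := congrArg BinForm.b e
      unfold invTranslate at *
      split_ifs at * <;> simp only at * <;> omega
    · intro e
      have := congrArg BinForm.b e
      unfold invTranslate translate at *
      split_ifs at * <;> simp only at * <;> omega
    · have h1 : (r.a + r.c) % 2 = 0 := by omega
      simp only [h1, h, true_and, not_false_eq_true]
      rfl
  · rw [Set.ncard_eq_one]
    rcases Int.emod_two_eq_zero_or_one r.a with ha | ha <;>
      rcases Int.emod_two_eq_zero_or_one r.c with hc | hc
    · refine ⟨r, ?_⟩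
      have h1 : (r.a + r.c) % 2 = 0 := by omega
      simp [h1, ha, hc]
    · refine ⟨r.translate, ?_⟩
      have h1 : (r.a + r.c) % 2 = 1 := by omega
      have h2 : ¬(r.a = r.b ∧ r.b = r.c) := by omega
      simp [h1, ha, hc, -not_and, h2]
    · refine ⟨r.invTranslate, ?_⟩
      have h1 : (r.a + r.c) % 2 = 1 := by omega
      simp [h1, ha, hc]
    -- For `a(x² + xy + y²)` the translate `(a, -a, a)` violates `b_pos` and `invTranslate` returns
    -- `r` itself.
    · refine ⟨r, ?_⟩
      have h1 : (r.a + r.c) % 2 = 0 := by omega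
      have h2 : r.a = r.b ∧ r.b = r.c := by tauto
      have h3 : r.invTranslate = r := by
        unfold invTranslate
        rw [if_pos (by omega)]
        ext <;> simp only <;> omega
      ext g
      simp only [Set.mem_ofPred_eq, h2, h3, Set.mem_singleton_iff]
      tauto

theorem Reduced.exists_of_a_le {f : BinForm} (ha : 0 < f.a) (h1 : |f.b| ≤ f.a)
    (h2 : f.a ≤ f.c) : ∃ r : BinForm, r.Reduced ∧ f.Equivalent r := by
  rw [abs_le] at h1
  rcases eq_or_lt_of_le h1.1 with h | h
  · refine ⟨⟨f.a, f.a, f.c⟩, ⟨ha, by simp only; omega, le_rfl, h2, fun _ => ha.le⟩, ?_⟩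
    apply equivalent_of_coeffs 1 1 0 1 <;> linarith
  · by_cases h3 : f.a = f.c ∧ f.b < 0
    · refine ⟨⟨f.a, -f.b, f.a⟩, ⟨ha, ?_, ?_, le_rfl, ?_⟩, ?_⟩
      iterate 3 simp only; omega
      apply equivalent_of_coeffs 0 (-1) 1 0 <;> linarith
    · exact ⟨f, ⟨ha, h, h1.2, h2, by omega⟩, .refl f⟩

end BinForm

/-! ### Theta-reduced forms counted by weighted classes. -/

/-- Every class contains a reduced form. -/
theorem FormClass.exists_reduced_rep {N : ℕ} (C : FormClass N) :
    ∃ f : PosDefForm N, (Quotient.mk (formSetoid N) f) = C ∧ f.1.Reduced := by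
  obtain ⟨f, rfl, ha, hb, hc⟩ := C.exists_reduced
  obtain ⟨r, hr, he⟩ := BinForm.Reduced.exists_of_a_le ha hb hc
  have hd : r.disc = -(N : ℤ) := he.disc_eq.trans f.2.2
  have hN : r.disc < 0 := by
    obtain ⟨h1, h2, h3, h4, -⟩ := hr
    simp only [BinForm.disc]
    nlinarith
  exact ⟨⟨r, BinForm.posDef_of_disc_neg hr.a_pos hN, hd⟩, Quotient.sound he.symm, hr⟩

/-- The theta-reduced forms of discriminant `-N`. -/
abbrev ThetaReducedForm (N : ℕ) : Type :=
  {f : BinForm // f.ThetaReduced ∧ f.disc = -(N : ℤ)}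

theorem BinForm.ThetaReduced.posDef {f : BinForm} (hf : f.ThetaReduced) : f.PosDef := by
  obtain ⟨h1, h2, h3, -, -⟩ := hf
  refine posDef_of_disc_neg (by omega) ?_
  simp only [disc]
  nlinarith

/-- The class of a theta-reduced form. -/
def ThetaReducedForm.toClass {N : ℕ} (f : ThetaReducedForm N) : FormClass N :=
  Quotient.mk (formSetoid N) ⟨f.1, f.2.1.posDef, f.2.2⟩

theorem BinForm.b_odd_of_disc {N : ℕ} (hN : N % 4 = 3) {r : BinForm}
    (hd : r.disc = -(N : ℤ)) : r.b % 2 = 1 := by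
  simp only [disc, mul_assoc] at hd
  rcases Int.emod_two_eq_zero_or_one r.b with h0 | h0
  · have : r.b ^ 2 % 2 = 0 := by rw [pow_two, Int.mul_emod, h0]; rfl
    omega
  · exact h0

/-- Since `b` is odd, `b² ≡ 1 (mod 8)`, and `4ac = b² + N` fixes the parity of `ac`. -/
theorem BinForm.a_c_odd_iff {N : ℕ} (hN : N % 4 = 3) {r : BinForm}
    (hd : r.disc = -(N : ℤ)) : r.a % 2 = 1 ∧ r.c % 2 = 1 ↔ N % 8 = 3 := by
  have hb := b_odd_of_disc hN hd
  have hb8 : r.b ^ 2 % 8 = 1 := by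
    rcases (by omega : r.b % 8 = 1 ∨ r.b % 8 = 3 ∨ r.b % 8 = 5 ∨ r.b % 8 = 7) with h | h | h | h <;>
      rw [pow_two, Int.mul_emod, h] <;> rfl
  simp only [disc, mul_assoc] at hd
  have hac := Int.mul_emod r.a r.c 2
  rcases Int.emod_two_eq_zero_or_one r.a with ha | ha <;>
    rcases Int.emod_two_eq_zero_or_one r.c with hc | hc <;>
    rw [ha, hc] at hac <;> omega

/-- Multiples of `x² + y²` have even middle coefficient and cannot occur; multiples of `x² + xy +
y²` are already reduced, so uniqueness identifies them. -/
theorem FormClass.weight_eq {N : ℕ} (hN : N % 4 = 3) (f : PosDefForm N) (hf : f.1.Reduced) :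
    FormClass.weight (Quotient.mk (formSetoid N) f) =
      if f.1.a = f.1.b ∧ f.1.b = f.1.c then 1 / 3 else 1 := by
  unfold FormClass.weight
  rw [if_neg]
  · congr 1
    apply propext
    constructor
    · rintro ⟨g, hg, k, hk⟩
      simp only [mul_one] at hk
      have hk0 : 0 < k := by simpa [hk] using g.2.1.a_pos
      have hgr : g.1.Reduced := by
        rw [hk]
        exact ⟨hk0, by simp only; omega, le_rfl, le_rfl, fun _ => hk0.le⟩
      have : f.1 = g.1 := hgr.eq_of_equivalent hf (Quotient.exact hg)
      rw [this, hk]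
      exact ⟨rfl, rfl⟩
    · rintro ⟨h1, h2⟩
      refine ⟨f, rfl, f.1.a, ?_⟩
      ext <;> simp only <;> omega
  · rintro ⟨g, -, k, hk⟩
    have := BinForm.b_odd_of_disc hN g.2.2
    rw [hk] at this
    simp at this

theorem ThetaReducedForm.card_fiber {N : ℕ} (hN : N % 4 = 3) (C : FormClass N) :
    (Nat.card {f : ThetaReducedForm N // f.toClass = C} : ℚ) =
      (if N % 8 = 3 then 3 else 1) * C.weight := by
  obtain ⟨r, rfl, hr⟩ := C.exists_reduced_rep
  have hb := BinForm.b_odd_of_disc hN r.2.2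
  have hac := BinForm.a_c_odd_iff hN r.2.2
  have hd : r.1.disc % 2 = 1 := by rw [r.2.2]; omega
  have hcard : Nat.card {f : ThetaReducedForm N // f.toClass = Quotient.mk (formSetoid N) r} =
      {g : BinForm | g.ThetaReduced ∧
        (g = r.1 ∨ g = r.1.translate ∨ g = r.1.invTranslate)}.ncard := by
    rw [← Nat.card_coe_set_eq]
    refine Nat.card_congr ⟨fun f => ⟨f.1.1, ?_⟩, fun g => ⟨⟨g.1, ?_⟩, ?_⟩, ?_, ?_⟩
    · exact (hr.thetaReduced_equivalent_iff hd).1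
        ⟨f.1.2.1, BinForm.Equivalent.symm (Quotient.exact f.2)⟩
    · have h := (hr.thetaReduced_equivalent_iff hd).2 g.2
      exact ⟨h.1, h.2.disc_eq.trans r.2.2⟩
    · have h := (hr.thetaReduced_equivalent_iff hd).2 g.2
      exact Quotient.sound h.2.symm
    · exact fun f => rfl
    · exact fun g => rfl
  rw [hcard, hr.ncard_thetaReduced hb, FormClass.weight_eq hN r hr]
  simp only [← and_assoc (a := r.1.a % 2 = 1), hac]
  by_cases h8 : N % 8 = 3
  · by_cases h : r.1.a = r.1.b ∧ r.1.b = r.1.c <;> simp [h8, h, -not_and]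
  · have h : ¬(r.1.a = r.1.b ∧ r.1.b = r.1.c) := by
      rintro ⟨h1, h2⟩
      exact h8 (hac.1 ⟨by omega, by omega⟩)
    simp [h8, h, -not_and]

theorem card_thetaReducedForm {N : ℕ} (hN : N % 4 = 3) :
    (Nat.card (ThetaReducedForm N) : ℚ) = kroneckerF N := by
  -- `Nat.card` of an infinite type is `0`, so the nonzero value from `card_fiber` already proves
  -- finiteness of the fibers.
  have hfin : ∀ C : FormClass N, Finite {f : ThetaReducedForm N // f.toClass = C} := by
    intro C
    apply Nat.finite_of_card_ne_zero
    intro h0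
    have h := ThetaReducedForm.card_fiber hN C
    rw [h0] at h
    have hw : C.weight ≠ 0 := by
      unfold FormClass.weight
      split_ifs <;> norm_num
    revert h
    split_ifs <;> simp [hw, hw.symm]
  have := Fintype.ofFinite (FormClass N)
  rw [← Nat.card_congr (Equiv.sigmaFiberEquiv (ThetaReducedForm.toClass (N := N))),
    Nat.card_sigma]
  push_cast
  simp only [ThetaReducedForm.card_fiber hN]
  have hH : hurwitzH N = ∑ C : FormClass N, C.weight := by
    have h0 : N ≠ 0 := by omega
    have h12 : ¬(N % 4 = 1 ∨ N % 4 = 2) := by omega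
    rw [hurwitzH, if_neg h0, if_neg h12, finsum_eq_sum_of_fintype]
  rw [← Finset.mul_sum, kroneckerF, hH]
  rcases (by omega : N % 8 = 3 ∨ N % 8 = 7) with h8 | h8 <;> simp [h8]

/-! ### Compositions described by a peak and two descents. -/

/-- The list `p, p - 1, …` of length `i`. -/
def descList : ℕ → ℕ → List ℕ
  | _, 0 => []
  | p, i + 1 => p :: descList (p - 1) i

theorem descList_length (p i : ℕ) : (descList p i).length = i := by
  induction i generalizing p with
  | zero => rfl
  | succ i ih => simp [descList, ih]

theorem descList_pos {p i : ℕ} (h : i ≤ p) : ∀ x ∈ descList p i, 0 < x := by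
  induction i generalizing p with
  | zero => simp [descList]
  | succ i ih =>
    simp only [descList, List.mem_cons]
    rintro x (rfl | hx)
    · omega
    · exact ih (by omega) x hx

theorem two_mul_sum_descList {p i : ℕ} (h : i ≤ p) :
    2 * ((descList p i).sum : ℤ) = i * (2 * p - i + 1) := by
  induction i generalizing p with
  | zero => simp [descList]
  | succ i ih =>
    have := ih (p := p - 1) (by omega)
    simp only [descList, List.sum_cons]
    push_cast [Nat.cast_sub (by omega : 1 ≤ p)] at this ⊢
    linear_combination this

theorem descList_isChain {p i : ℕ} (h : i ≤ p) :
    (descList p i).IsChain (fun a b => a = b + 1) := by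
  induction i generalizing p with
  | zero => simp [descList]
  | succ i ih =>
    rw [descList, List.isChain_cons]
    refine ⟨?_, ih (by omega)⟩
    cases i with
    | zero => simp [descList]
    | succ i => simp [descList]; omega

theorem eq_descList {l : List ℕ} {p : ℕ} (h : (p :: l).IsChain (fun a b => a = b + 1))
    (hpos : ∀ x ∈ p :: l, 0 < x) : l.length + 1 ≤ p ∧ l = descList (p - 1) l.length := by
  induction l generalizing p with
  | nil => exact ⟨hpos p (by simp), rfl⟩
  | cons q l ih =>
    rw [List.isChain_cons_cons] at h
    have := ih h.2 (fun x hx => hpos x (List.mem_cons_of_mem _ hx))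
    have hq : p - 1 = q := by omega
    rw [hq, List.length_cons, descList]
    exact ⟨by omega, by rw [← this.2]⟩

/-- The list rising by `i` steps of size `1` to `p`, then falling by `j` steps. -/
def peakList (p i j : ℕ) : List ℕ :=
  (descList (p - 1) i).reverse ++ p :: descList (p - 1) j

theorem peakList_pos {p i j : ℕ} (hi : i < p) (hj : j < p) : ∀ x ∈ peakList p i j, 0 < x := by
  intro x hx
  simp only [peakList, List.mem_append, List.mem_reverse, List.mem_cons] at hx
  rcases hx with hx | rfl | hx
  exacts [descList_pos (by omega) x hx, by omega, descList_pos (by omega) x hx]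

theorem four_mul_sum_peakList {p i j : ℕ} (hi : i < p) (hj : j < p) :
    4 * ((peakList p i j).sum : ℤ) - 1 =
      4 * (p : ℤ) ^ 2 - (2 * p - i - j - 1) ^ 2 - (j - i) ^ 2 := by
  have h1 := two_mul_sum_descList (p := p - 1) (i := i) (by omega)
  have h2 := two_mul_sum_descList (p := p - 1) (i := j) (by omega)
  simp only [peakList, List.sum_append, List.sum_reverse, List.sum_cons]
  push_cast [Nat.cast_sub (by omega : 1 ≤ p)] at h1 h2 ⊢
  linear_combination 2 * h1 + 2 * h2

theorem isChain_cons_descList {p i : ℕ} (h : i < p) :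
    (p :: descList (p - 1) i).IsChain (fun a b => a = b + 1) :=
  descList_isChain (i := i + 1) (by omega)

theorem isChain_reverse_descList {p i : ℕ} (h : i < p) :
    ((descList (p - 1) i).reverse ++ [p]).IsChain (fun a b => b = a + 1) := by
  rw [← List.reverse_cons, List.isChain_reverse]
  exact isChain_cons_descList h

theorem stronglyUnimodal_peakList {p i j : ℕ} (hi : i < p) (hj : j < p) :
    StronglyUnimodal (peakList p i j) :=
  ⟨_, _, _, rfl, (isChain_reverse_descList hi).imp fun a b h => by omega,
    (isChain_cons_descList hj).imp fun a b h => by omega⟩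

/-- The casts in `StepsOne` elaborate to a chain on the list mapped into `ℤ`; this returns to a
chain on `l` itself. -/
theorem stepsOne_iff (l : List ℕ) :
    StepsOne l ↔ l.IsChain (fun a b : ℕ => |(a : ℤ) - (b : ℤ)| = 1) := by
  have : (do let a ← l; pure (a : ℤ)) = l.map (fun a : ℕ => (a : ℤ)) := by
    simp [List.bind_eq_flatMap, List.map_eq_flatMap]
  unfold StepsOne
  rw [this, List.isChain_map]

theorem stepsOne_peakList {p i j : ℕ} (hi : i < p) (hj : j < p) :
    StepsOne (peakList p i j) := by
  rw [stepsOne_iff, peakList, List.isChain_split]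
  refine ⟨(isChain_reverse_descList hi).imp fun a b h => ?_,
    (isChain_cons_descList hj).imp fun a b h => ?_⟩
  · rw [h]; simp
  · rw [h]; simp

theorem List.IsChain.and_of_isChain {α : Type*} {R S : α → α → Prop} {l : List α}
    (hR : l.IsChain R) (hS : l.IsChain S) : l.IsChain (fun a b => R a b ∧ S a b) := by
  rw [List.isChain_iff_getElem] at *
  exact fun i hi => ⟨hR i hi, hS i hi⟩

theorem exists_eq_peakList {l : List ℕ} (hpos : ∀ x ∈ l, 0 < x) (hu : StronglyUnimodal l)
    (hs : StepsOne l) : ∃ p i j, i < p ∧ j < p ∧ l = peakList p i j := by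
  obtain ⟨l₁, p, l₂, rfl, h1, h2⟩ := hu
  rw [stepsOne_iff, List.isChain_split] at hs
  have c1 : (p :: l₁.reverse).IsChain (fun a b => a = b + 1) := by
    have : (l₁ ++ [p]).IsChain (fun a b => b = a + 1) := by
      refine (h1.and_of_isChain hs.1).imp fun a b ⟨hlt, habs⟩ => ?_
      rw [abs_of_neg (by omega)] at habs
      omega
    rw [← List.isChain_reverse] at this
    simpa using this
  have c2 : (p :: l₂).IsChain (fun a b => a = b + 1) := by
    refine (h2.and_of_isChain hs.2).imp fun a b ⟨hlt, habs⟩ => ?_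
    rw [abs_of_pos (by omega)] at habs
    omega
  have e1 := eq_descList c1 (fun x hx => hpos x (by simp at hx ⊢; tauto))
  have e2 := eq_descList c2 (fun x hx => hpos x (by simp at hx ⊢; tauto))
  refine ⟨p, l₁.reverse.length, l₂.length, by omega, by omega, ?_⟩
  rw [peakList, ← e1.2, ← e2.2, List.reverse_reverse]

theorem descList_le {p i : ℕ} : ∀ x ∈ descList p i, x ≤ p := by
  induction i generalizing p with
  | zero => simp [descList]
  | succ i ih =>
    simp only [descList, List.mem_cons]
    rintro x (rfl | hx)
    · exact le_rfl
    · exact (ih x hx).trans (Nat.sub_le _ _)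

theorem peakList_le (p i j : ℕ) : ∀ x ∈ peakList p i j, x ≤ p := by
  intro x hx
  simp only [peakList, List.mem_append, List.mem_reverse, List.mem_cons] at hx
  rcases hx with hx | rfl | hx
  · exact (descList_le x hx).trans (Nat.sub_le _ _)
  · exact le_rfl
  · exact (descList_le x hx).trans (Nat.sub_le _ _)

theorem mem_peakList (p i j : ℕ) : p ∈ peakList p i j := by simp [peakList]

theorem peakList_injective {p i j p' i' j' : ℕ} (hp : 0 < p)
    (h : peakList p i j = peakList p' i' j') : p = p' ∧ i = i' ∧ j = j' := by
  obtain rfl : p = p' := le_antisymm (peakList_le _ _ _ _ (h ▸ mem_peakList p i j))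
    (peakList_le _ _ _ _ (h ▸ mem_peakList p' i' j'))
  -- The peak value occurs only once, so it determines where the list splits.
  have hnot : ∀ k, p ∉ descList (p - 1) k := fun k hk => by
    have := descList_le _ hk
    omega
  have := (List.append_cons_inj_of_notMem (by simpa using hnot i) (hnot j)).1 h
  refine ⟨rfl, ?_, ?_⟩
  · simpa [descList_length] using congrArg List.length this.1
  · simpa [descList_length] using congrArg List.length this.2.2

/-- Peaks `p` and numbers `i`, `j` of steps before and after it, for compositions of `n`. -/
abbrev PeakData (n : ℕ) : Type :=
  {x : ℕ × ℕ × ℕ // x.2.1 < x.1 ∧ x.2.2 < x.1 ∧ (peakList x.1 x.2.1 x.2.2).sum = n}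

theorem numP_eq_card_peakData (n : ℕ) : numP n = Nat.card (PeakData n) := by
  symm
  refine Nat.card_eq_of_bijective (fun x => ⟨⟨peakList x.1.1 x.1.2.1 x.1.2.2,
    fun {_} h => peakList_pos x.2.1 x.2.2.1 _ h, x.2.2.2⟩,
    stronglyUnimodal_peakList x.2.1 x.2.2.1, stepsOne_peakList x.2.1 x.2.2.1⟩) ⟨?_, ?_⟩
  · intro x y h
    simp only [Subtype.mk.injEq, Composition.mk.injEq] at h
    have := peakList_injective (Nat.zero_lt_of_lt x.2.1) h
    exact Subtype.ext (Prod.ext this.1 (Prod.ext this.2.1 this.2.2))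
  · rintro ⟨⟨l, hpos, hsum⟩, hu, hs⟩
    obtain ⟨p, i, j, hi, hj, rfl⟩ := exists_eq_peakList (fun x hx => hpos hx) hu hs
    exact ⟨⟨(p, i, j), hi, hj, hsum⟩, rfl⟩

/-! ### The bijection between peaks and theta-reduced forms. -/

/-- The theta-reduced form attached to a peak `p` with `i` steps before and `j` steps after. -/
def peakForm (p i j : ℤ) : BinForm :=
  -- Here `u = 2p - i - j - 1` is odd and `v = j - i` even: `c - a` is `|v|`, and the lost sign of
  -- `v` is stored in `b = ±u`. For `v = 0` the choice `b = u` agrees with `b_pos`. In the other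
  -- parity `u` is the even one; it is positive, so no sign is lost.
  if (i + j) % 2 = 0 then
    if i ≤ j then ⟨p - (j - i) / 2, 2 * p - i - j - 1, p + (j - i) / 2⟩
    else ⟨p - (i - j) / 2, -(2 * p - i - j - 1), p + (i - j) / 2⟩
  else ⟨p - (2 * p - i - j - 1) / 2, j - i, p + (2 * p - i - j - 1) / 2⟩

theorem thetaReduced_peakForm {p i j : ℤ} (hi : 0 ≤ i) (hj : 0 ≤ j) (hip : i < p)
    (hjp : j < p) : (peakForm p i j).ThetaReduced := by
  unfold peakForm
  constructor <;> split_ifs <;> simp only <;> omega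

theorem disc_peakForm (p i j : ℤ) :
    (peakForm p i j).disc = -(4 * p ^ 2 - (2 * p - i - j - 1) ^ 2 - (j - i) ^ 2) := by
  unfold peakForm
  split_ifs with h1 h2
  · obtain ⟨k, hk⟩ : ∃ k, j = i + 2 * k := ⟨(j - i) / 2, by omega⟩
    have : (j - i) / 2 = k := by omega
    simp only [this, BinForm.disc]; rw [hk]; ring
  · obtain ⟨k, hk⟩ : ∃ k, i = j + 2 * k := ⟨(i - j) / 2, by omega⟩
    have : (i - j) / 2 = k := by omega
    simp only [this, BinForm.disc]; rw [hk]; ring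
  · obtain ⟨k, hk⟩ : ∃ k, i = 2 * p - j - 1 - 2 * k := ⟨(2 * p - i - j - 1) / 2, by omega⟩
    have : (2 * p - i - j - 1) / 2 = k := by omega
    simp only [this, BinForm.disc]; rw [hk]; ring

theorem peakForm_injective {p i j p' i' j' : ℤ} (hip : i < p) (hjp : j < p)
    (hip' : i' < p') (hjp' : j' < p')
    (h : peakForm p i j = peakForm p' i' j') : p = p' ∧ i = i' ∧ j = j' := by
  unfold peakForm at h
  split_ifs at h <;> simp only [BinForm.mk.injEq] at h <;> omega

theorem BinForm.ThetaReduced.exists_peakForm {f : BinForm} (hf : f.ThetaReduced)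
    (hb : f.b % 2 = 1) :
    ∃ p i j : ℕ, i < p ∧ j < p ∧ peakForm p i j = f := by
  obtain ⟨h1, h2, h3, h4, h5⟩ := hf
  obtain ⟨a, b, c⟩ := f
  simp only at *
  have key : ∃ p i j : ℤ, 0 ≤ i ∧ 0 ≤ j ∧ i < p ∧ j < p ∧ peakForm p i j = ⟨a, b, c⟩ := by
    -- In terms of `p = (a + c) / 2`, `u = 2 * p - i - j - 1`, `v = j - i`.
    have of_uv : ∀ u v : ℤ, (u + v) % 2 = 1 → -u < v → v < u → u + v < a + c →
        u - v < a + c →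
        (v % 2 = 0 → (0 ≤ v → b = u ∧ c - a = v) ∧ (v < 0 → b = -u ∧ c - a = -v)) →
        (v % 2 = 1 → b = v ∧ c - a = u) →
        ∃ p i j : ℤ, 0 ≤ i ∧ 0 ≤ j ∧ i < p ∧ j < p ∧ peakForm p i j = ⟨a, b, c⟩ := by
      intro u v huv g1 g2 g3 g4 g5 g6
      refine ⟨(a + c) / 2, (a + c) / 2 - (u + v + 1) / 2, (a + c) / 2 - (u - v + 1) / 2,
        by omega, by omega, by omega, by omega, ?_⟩
      unfold peakForm
      split_ifs <;> ext <;> simp only <;> omega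
    -- Since `i, j < p` means `|v| < u`, the larger of `|b|` and `c - a` must be `u`. They differ in
    -- parity, so there is no tie.
    by_cases g1 : c - a < b
    · exact of_uv b (c - a) (by omega) (by omega) (by omega) (by omega) (by omega) (by omega)
        (by omega)
    · by_cases g2 : b < -(c - a)
      · exact of_uv (-b) (-(c - a)) (by omega) (by omega) (by omega) (by omega) (by omega)
          (by omega) (by omega)
      · exact of_uv (c - a) b (by omega) (by omega) (by omega) (by omega) (by omega) (by omega)
          (by omega)
  obtain ⟨p, i, j, hi, hj, hip, hjp, h⟩ := key
  lift i to ℕ using hi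
  lift j to ℕ using hj
  lift p to ℕ using by omega
  exact ⟨p, i, j, by omega, by omega, h⟩

theorem card_peakData {n : ℕ} (hn : 1 ≤ n) :
    Nat.card (PeakData n) = Nat.card (ThetaReducedForm (4 * n - 1)) := by
  have hcast : ((4 * n - 1 : ℕ) : ℤ) = 4 * (n : ℤ) - 1 := by omega
  refine Nat.card_eq_of_bijective (fun x => ⟨peakForm x.1.1 x.1.2.1 x.1.2.2,
    thetaReduced_peakForm (by omega) (by omega) (by have := x.2.1; omega)
      (by have := x.2.2.1; omega), ?_⟩) ⟨?_, ?_⟩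
  · rw [disc_peakForm, ← four_mul_sum_peakList x.2.1 x.2.2.1, x.2.2.2, hcast]
  · intro x y h
    simp only [Subtype.mk.injEq] at h
    have hx := x.2
    have hy := y.2
    have := peakForm_injective (by omega) (by omega) (by omega) (by omega) h
    exact Subtype.ext (Prod.ext (by omega) (Prod.ext (by omega) (by omega)))
  · rintro ⟨f, hf, hd⟩
    obtain ⟨p, i, j, hi, hj, rfl⟩ :=
      hf.exists_peakForm (BinForm.b_odd_of_disc (by omega) hd)
    refine ⟨⟨(p, i, j), hi, hj, ?_⟩, rfl⟩
    rw [disc_peakForm, ← four_mul_sum_peakList hi hj] at hd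
    simp only
    omega

theorem mainTheorem5 (n : ℕ) (hn : 1 ≤ n) : (numP n : ℚ) = kroneckerF (4 * n - 1) := by
  rw [numP_eq_card_peakData, card_peakData hn, card_thetaReducedForm (by omega)]
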